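/- **Definitions.** Let $\mathbb{T}^d=\mathbb{R}^d/\mathbb{Z}^d$. An *affine $d$-dimensional tori bundle* $\pi:\Omega\to M$ ($n,d\ge 1$) consists of a $\mathcal{C}^1$ manifold $M$ of dimension $n$, a $\mathcal{C}^1$ manifold $\Omega$ (of dimension $n+d$), a $\mathcal{C}^1$ projection $\pi$, and a family of charts, that is, of $\mathcal{C}^1$ diffeomorphisms $\psi_U:\pi^{-1}(U)\to U\times\mathbb{T}^d$ over open sets $U$ covering $M$, with first component $\pi$, whose changes of charts have the form $(x,y)\mapsto(x,\alpha_{U,V}(x)+A_{U,V}\,y)$ on $(U\cap V)\times\mathbb{T}^d$, where $\alpha_{U,V}:U\cap V\to\mathbb{T}^d$ is $\mathcal{C}^1$ and $A_{U,V}$ is locally constant on $U\cap V$ with values in $GL_d(\mathbb{Z})$. A flow $(g_t)_{t\in\mathbb{R}}$ on $\Omega$ is *compatible* if for every chart $\psi_U$ there is $v_U\in\mathcal{C}^1(U,\mathbb{R}^d)$ with $\psi_U\circ g_t\circ\psi_U^{-1}(x,y)=(x,y+t\,v_U(x))$ for all $t\in\mathbb{R}$, $x\in U$, $y\in\mathbb{T}^d$.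 A measure $\mu$ on $\Omega$ is *compatible* if for every chart $\psi_U$, $(\psi_U)_*(\mu|_{\pi^{-1}(U)})=(\pi_*\mu)|_U\otimes\mathrm{Leb}_{\mathbb{T}^d}$. A subset of a $\mathcal{C}^1$ manifold is Lebesgue-null if its image in every coordinate chart of the manifold is Lebesgue-null; $\mu$ is *absolutely continuous* if it vanishes on Borel Lebesgue-null sets. **Theorem.** Let $\pi:\Omega\to M$ be an affine $d$-dimensional tori bundle, $(g_t)_{t\in\mathbb{R}}$ a compatible flow on $\Omega$, with velocities $v_U$ in the charts, and $\mu$ an absolutely continuous compatible Borel probability measure on $\Omega$. Suppose that the set $\bigcup_{\xi\in\mathbb{Z}^d\setminus\{0\}}\{\mathrm{d}\langle\xi,v\rangle=0\}\subset M$ is Lebesgue-null; here $x\in M$ belongs to this set if $\mathrm{d}\langle\xi,v_U\rangle(x)=0$ for some $\xi\in\mathbb{Z}^d\setminus\{0\}$ and some chart $\psi_U$ with $x\in U$ (the set does not depend on the choice of the chart at $x$, since $v$ changes by an element of $GL_d(\mathbb{Z})$). Then $(\Omega,\mu,(g_t))$ exhibits *Keplerian shear*: each $g_t$ preserves $\mu$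 and, for every $f\in L^2(\Omega,\mu;\mathbb{C})$, $$f\circ g_t\ \longrightarrow\ \mathbb{E}_\mu(f\mid\mathcal{I})\qquad(t\to+\infty)$$ in the weak topology of $L^2(\Omega,\mu)$, where $\mathcal{I}$ is the $\sigma$-algebra of Borel sets $B\subset\Omega$ with $g_t^{-1}(B)=B$ for all $t\in\mathbb{R}$. -/

import Mathlib

open MeasureTheory Filter Topology Set
open scoped Manifold

/-- The quotient map `ℝ^d → 𝕋^d = ℝ^d / ℤ^d`. -/
noncomputable def torusMk {d : ℕ} (y : Fin d → ℝ) : UnitAddTorus (Fin d) :=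
  fun i => ((y i : ℝ) : UnitAddCircle)

/-- The automorphism of `𝕋^d` induced by an element of `GL_d(ℤ)`. -/
noncomputable def torusAut {d : ℕ} (A : GL (Fin d) ℤ) (y : UnitAddTorus (Fin d)) :
    UnitAddTorus (Fin d) :=
  fun i => ∑ j, (A : Matrix (Fin d) (Fin d) ℤ) i j • y j

/-- A torus-valued map on a manifold `N` is `C^1` on an open set `s` if, near every point of `s`,
it is the projection of a `C^1` map to `ℝ^d` (the quotient map `ℝ^d → 𝕋^d` being a local
diffeomorphism for the usual `C^1` structure of the torus). -/
def TorusC1On {k d : ℕ} {N : Type*} [TopologicalSpace N]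
    [ChartedSpace (EuclideanSpace ℝ (Fin k)) N]
    (f : N → UnitAddTorus (Fin d)) (s : Set N) : Prop :=
  ∀ x ∈ s, ∃ F : N → (Fin d → ℝ), ContMDiffAt (𝓡 k) 𝓘(ℝ, Fin d → ℝ) 1 F x ∧
    ∀ᶠ y in 𝓝 x, f y = torusMk (F y)

/-- A subset of a `C^1` manifold has zero Lebesgue measure: its trace on every chart domain is
mapped by the chart to a Lebesgue-null subset of `ℝ^k`. -/
def LebesgueNull {k : ℕ} {N : Type*} [TopologicalSpace N]
    [ChartedSpace (EuclideanSpace ℝ (Fin k)) N] (s : Set N) : Prop :=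
  ∀ φ ∈ atlas (EuclideanSpace ℝ (Fin k)) N, volume (φ '' (s ∩ φ.source)) = 0

/-- `μ ≪ Leb` on a `C^1` manifold. -/
def AbsContLebesgue {k : ℕ} {N : Type*} [TopologicalSpace N]
    [ChartedSpace (EuclideanSpace ℝ (Fin k)) N] [MeasurableSpace N] (μ : Measure N) : Prop :=
  ∀ s : Set N, MeasurableSet s → LebesgueNull (k := k) s → μ s = 0

/-- An affine bundle of `d`-dimensional tori over an `n`-dimensional `C^1` manifold `M`, with total
space the `C^1` manifold `Ω`: a `C^1` projection, with an atlas of `C^1`-diffeomorphic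
trivializations whose transition maps take values in the affine group `𝕋^d ⋊ GL_d(ℤ)`. -/
structure AffineTorusBundle (n d : ℕ) (M Ω : Type*)
    [TopologicalSpace M] [ChartedSpace (EuclideanSpace ℝ (Fin n)) M]
    [TopologicalSpace Ω] [ChartedSpace (EuclideanSpace ℝ (Fin (n + d))) Ω] where
  /-- the projection -/
  proj : Ω → M
  contMDiff_proj : ContMDiff (𝓡 (n + d)) (𝓡 n) 1 proj
  /-- the trivializing charts `ψ_U : π⁻¹(U) → U × 𝕋^d` -/
  charts : Set (Bundle.Trivialization (UnitAddTorus (Fin d)) proj)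
  exists_chart : ∀ x : M, ∃ ψ ∈ charts, x ∈ ψ.baseSet
  /-- `ψ_U` is `C^1` (its first component is `proj`) -/
  chart_C1 : ∀ ψ ∈ charts, TorusC1On (k := n + d) (fun p => (ψ p).2) ψ.source
  /-- the inverse of `ψ_U` is `C^1`, read on `U × ℝ^d`, which covers `U × 𝕋^d` -/
  chart_symm_C1 : ∀ ψ ∈ charts,
    ContMDiffOn ((𝓡 n).prod 𝓘(ℝ, Fin d → ℝ)) (𝓡 (n + d)) 1
      (fun p : M × (Fin d → ℝ) => ψ.toOpenPartialHomeomorph.symm (p.1, torusMk p.2))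
      (ψ.baseSet ×ˢ univ)
  /-- changes of charts have the form `(x, y) ↦ (x, α(x) + A y)`, with `α` of class `C^1` and `A`
  locally constant -/
  transition : ∀ ψ ∈ charts, ∀ ψ' ∈ charts,
    ∃ (α : M → UnitAddTorus (Fin d)) (A : M → GL (Fin d) ℤ),
      TorusC1On (k := n) α (ψ.baseSet ∩ ψ'.baseSet) ∧
      (∀ x ∈ ψ.baseSet ∩ ψ'.baseSet, ∀ᶠ x' in 𝓝 x, A x' = A x) ∧
      ∀ x ∈ ψ.baseSet ∩ ψ'.baseSet, ∀ y : UnitAddTorus (Fin d),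
        ψ' (ψ.toOpenPartialHomeomorph.symm (x, y)) = (x, α x + torusAut (A x) y)

namespace AffineTorusBundle

variable {n d : ℕ} {M Ω : Type*}
  [TopologicalSpace M] [ChartedSpace (EuclideanSpace ℝ (Fin n)) M]
  [TopologicalSpace Ω] [ChartedSpace (EuclideanSpace ℝ (Fin (n + d))) Ω]

/-- `v` is a `C^1` velocity of the flow `g` in the chart `ψ` over `U`: `v ∈ C^1(U, ℝ^d)`, and for
all `t`, `g_t` acts in the chart as `(x, y) ↦ (x, y + t v(x))`. Such a `v` is unique on `U`. -/
def IsVelocity (B : AffineTorusBundle n d M Ω) (g : Flow ℝ Ω)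
    (ψ : Bundle.Trivialization (UnitAddTorus (Fin d)) B.proj) (v : M → (Fin d → ℝ)) : Prop :=
  ContMDiffOn (𝓡 n) 𝓘(ℝ, Fin d → ℝ) 1 v ψ.baseSet ∧
    ∀ t : ℝ, ∀ x ∈ ψ.baseSet, ∀ y : UnitAddTorus (Fin d),
      g t (ψ.toOpenPartialHomeomorph.symm (x, y)) =
        ψ.toOpenPartialHomeomorph.symm (x, y + torusMk (t • v x))

/-- The flow is compatible (on all charts of the bundle). -/
def CompatibleFlow (B : AffineTorusBundle n d M Ω) (g : Flow ℝ Ω) : Prop :=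
  ∀ ψ ∈ B.charts, ∃ v : M → (Fin d → ℝ), B.IsVelocity g ψ v

/-- The measure is compatible: in each chart over `U`, the restriction of `μ` to `π⁻¹(U)` is
`(π_* μ)|_U ⊗ Leb`, where `Leb` is the Lebesgue probability measure on `𝕋^d`. -/
def CompatibleMeasure [MeasurableSpace M] [MeasurableSpace Ω]
    (B : AffineTorusBundle n d M Ω) (μ : Measure Ω) : Prop :=
  ∀ ψ ∈ B.charts,
    (μ.restrict (B.proj ⁻¹' ψ.baseSet)).map ψ =
      ((μ.map B.proj).restrict ψ.baseSet).prod (volume : Measure (UnitAddTorus (Fin d)))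

/-- The union over `ξ ∈ ℤ^d ∖ {0}` of the critical sets `{d⟨ξ, v⟩ = 0}`. In a change of charts `v`
is replaced by `A v` with `A ∈ GL_d(ℤ)`, so this union does not depend on the charts. -/
def criticalSet (B : AffineTorusBundle n d M Ω) (g : Flow ℝ Ω) : Set M :=
  {x | ∃ ψ ∈ B.charts, x ∈ ψ.baseSet ∧ ∃ v : M → (Fin d → ℝ), B.IsVelocity g ψ v ∧
    ∃ ξ : Fin d → ℤ, ξ ≠ 0 ∧
      mfderiv (𝓡 n) 𝓘(ℝ, ℝ) (fun x' => ∑ i, (ξ i : ℝ) * v x' i) x = 0}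

end AffineTorusBundle

/-- The invariant `σ`-algebra of a family of transformations: the measurable sets `s` such that
`g_t⁻¹(s) = s` for all `t`. -/
@[reducible] def invariantSigmaAlgebra {Ω : Type*} [MeasurableSpace Ω] (g : ℝ → Ω → Ω) : MeasurableSpace Ω :=
  ⨅ t : ℝ, MeasurableSpace.invariants (g t)

/-- Keplerian shear of `(Ω, μ, (g_t))`: the `g_t` preserve `μ`, and for all `f ∈ L²(Ω, μ)`,
`f ∘ g_t` converges to `𝔼_μ(f | 𝓘)` in the weak topology of `L²(Ω, μ)` as `t → +∞`. -/
def KeplerianShear {Ω : Type*} [MeasurableSpace Ω] (μ : Measure Ω) (g : ℝ → Ω → Ω) : Prop :=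
  ∃ hg : ∀ t : ℝ, MeasurePreserving (g t) μ μ,
    ∀ f : Lp ℂ 2 μ,
      Tendsto (fun t : ℝ => toWeakSpace ℂ (Lp ℂ 2 μ) (Lp.compMeasurePreserving (g t) (hg t) f))
        atTop
        (𝓝 (toWeakSpace ℂ (Lp ℂ 2 μ)
          (((Lp.memLp f).condExp (m := invariantSigmaAlgebra g) one_le_two).toLp
            (μ[f | invariantSigmaAlgebra g]))))

/-! Over a chart, let e_ξ(y) be the character of index ξ in the fibre coordinate, cut off to the
fibres over a measurable set A of the base. The flow translates the fibre over x by t v(x), so it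
multiplies this monomial by exp(2πi t⟨ξ, v(x)⟩), a phase depending on x only
(`IsVelocity.fiberMonomial_flow`).

If ξ = 0 the monomial is invariant. If ξ ≠ 0, its correlation with any k in L² is an oscillatory
integral with phase ⟨ξ, v⟩. Off the critical set, ⟨ξ, v⟩ is a submersion to ℝ, so preimages of null
sets are null; with the nullity of the critical set and the absolute continuity of μ, the law of ⟨ξ,
v⟩ has a density (`map_velocity_absolutelyContinuous`). The Riemann-Lebesgue lemma then sends the
correlation to 0 (`tendsto_inner_fiberMonomial`).

The monomials are total in L² (`orthogonal_span_fiberMonomials`), and since the flow acts by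
isometries, convergence on a total family is enough (`KeplerianShear.of_dense_span`). The flow
preserves μ because translations preserve the Haar measure of the fibres. -/

/-! ### Reduction of weak convergence to a total family. -/

section WeakConvergence

variable {Ω : Type*} [MeasurableSpace Ω] {μ : Measure Ω} {g : ℝ → Ω → Ω}

lemma invariantSigmaAlgebra_le (g : ℝ → Ω → Ω) :
    invariantSigmaAlgebra g ≤ (inferInstance : MeasurableSpace Ω) :=
  (iInf_le _ 0).trans (MeasurableSpace.invariants_le _)

lemma measurableSet_invariantSigmaAlgebra {s : Set Ω} :
    MeasurableSet[invariantSigmaAlgebra g] s ↔ ∀ t, MeasurableSet s ∧ g t ⁻¹' s = s := by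
  simp only [MeasurableSpace.measurableSet_iInf,
    MeasurableSpace.measurableSet_invariants]

/-- A representative measurable for the invariant σ-algebra is invariant at every point, not only
almost everywhere. -/
lemma compMeasurePreserving_eq_self_of_aestronglyMeasurable
    (hg : ∀ t, MeasurePreserving (g t) μ μ) (t : ℝ) {f : Lp ℂ 2 μ}
    (hf : AEStronglyMeasurable[invariantSigmaAlgebra g] f μ) :
    Lp.compMeasurePreserving (g t) (hg t) f = f := by
  obtain ⟨w, hw, hfw⟩ := hf
  have hwt : w ∘ g t = w := MeasurableSpace.comp_eq_of_measurable_invariants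
    (hw.measurable.mono (iInf_le _ t) le_rfl)
  apply Lp.ext
  refine (Lp.coeFn_compMeasurePreserving f (hg t)).trans ?_
  refine ((hg t).quasiMeasurePreserving.ae_eq_comp hfw).trans ?_
  rw [hwt]
  exact hfw.symm

/-- To prove Keplerian shear it suffices to consider a total family of functions, each of which is
either invariant or weakly converging to zero along the flow. -/
lemma KeplerianShear.of_dense_span [IsFiniteMeasure μ] (hg : ∀ t, MeasurePreserving (g t) μ μ)
    (S : Set (Lp ℂ 2 μ)) (hS : (Submodule.span ℂ S)ᗮ = ⊥)
    (hSg : ∀ f ∈ S, AEStronglyMeasurable[invariantSigmaAlgebra g] f μ ∨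
      ∀ k : Lp ℂ 2 μ, Tendsto (fun t => inner ℂ k (Lp.compMeasurePreserving (g t) (hg t) f))
        atTop (𝓝 0)) :
    KeplerianShear μ g := by
  have hm := invariantSigmaAlgebra_le g
  let P : Lp ℂ 2 μ →L[ℂ] Lp ℂ 2 μ := (lpMeas ℂ ℂ (invariantSigmaAlgebra g) 2 μ).subtypeL ∘L
    condExpL2 ℂ ℂ hm
  let U : ℝ → Lp ℂ 2 μ →ₗᵢ[ℂ] Lp ℂ 2 μ := fun t => Lp.compMeasurePreservingₗᵢ ℂ (g t) (hg t)
  have hU : ∀ t f, U t f = Lp.compMeasurePreserving (g t) (hg t) f := fun _ _ => rfl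
  have hPm : ∀ f, AEStronglyMeasurable[invariantSigmaAlgebra g] (P f) μ := fun f =>
    aestronglyMeasurable_condExpL2 hm f
  have hUP : ∀ t f, U t (P f) = P f := fun t f =>
    compMeasurePreserving_eq_self_of_aestronglyMeasurable hg t (hPm f)
  have hPP : ∀ f k, inner ℂ (P f) k = inner ℂ f (P k) := fun f k =>
    inner_condExpL2_left_eq_right hm
  have hPf : ∀ f : Lp ℂ 2 μ, ((Lp.memLp f).condExp (m := invariantSigmaAlgebra g)
      one_le_two).toLp (μ[f | invariantSigmaAlgebra g]) = P f := by
    intro f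
    apply Lp.ext
    refine (MemLp.coeFn_toLp _).trans ?_
    have := (Lp.memLp f).condExpL2_ae_eq_condExp (𝕜 := ℂ) hm
    rw [Lp.toLp_coeFn] at this
    exact this.symm
  let W : Submodule ℂ (Lp ℂ 2 μ) :=
    -- The `f` with the desired limit form a subspace; it is shown to be closed and to contain `S`,
    -- hence to be everything.
    { carrier := {f | ∀ k, Tendsto (fun t => inner ℂ k (U t f)) atTop (𝓝 (inner ℂ k (P f)))}
      zero_mem' := fun k => by simp
      add_mem' := fun {a b} ha hb k => by simpa [inner_add_right] using (ha k).add (hb k)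
      smul_mem' := fun c a ha k => by simpa [inner_smul_right] using (ha k).const_mul c }
  have hW : IsClosed (W : Set (Lp ℂ 2 μ)) := by
    rw [← isSeqClosed_iff_isClosed]
    intro u f hu huf k
    -- The approximation is uniform in `t` because each `U t` is an isometry; this permits
    -- exchanging the limits in `n` and `t`.
    have h1 : TendstoUniformly (fun n t => inner ℂ k (U t (u n))) (fun t => inner ℂ k (U t f))
        atTop := by
      rw [Metric.tendstoUniformly_iff]
      intro ε hε
      have h0 : Tendsto (fun n => ‖k‖ * ‖f - u n‖) atTop (𝓝 (‖k‖ * ‖f - f‖)) :=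
        (tendsto_const_nhds.sub huf).norm.const_mul _
      simp only [sub_self, norm_zero, mul_zero] at h0
      filter_upwards [h0.eventually_lt_const hε] with n hn t
      rw [dist_eq_norm, ← inner_sub_right, ← map_sub]
      refine (norm_inner_le_norm _ _).trans_lt ?_
      rwa [(U t).norm_map]
    have h2 : Tendsto (fun n => inner ℂ k (P (u n))) atTop (𝓝 (inner ℂ k (P f))) :=
      tendsto_const_nhds.inner ((P.continuous.tendsto f).comp huf)
    exact h1.tendsto_of_eventually_tendsto (Eventually.of_forall fun n => hu n k) h2
  have hSW : S ⊆ W := by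
    intro f hf k
    rcases hSg f hf with h | h
    · have : Fact (invariantSigmaAlgebra g ≤ (inferInstance : MeasurableSpace Ω)) := ⟨hm⟩
      have h1 : P f = f := congrArg Subtype.val
        (Submodule.orthogonalProjectionOnto_mem_subspace_eq_self
          (⟨f, (mem_lpMeas_iff_aestronglyMeasurable).2 h⟩ :
            lpMeas ℂ ℂ (invariantSigmaAlgebra g) 2 μ))
      have h2 : ∀ t, U t f = f := fun t =>
        compMeasurePreserving_eq_self_of_aestronglyMeasurable hg t h
      simp only [h1, h2]
      exact tendsto_const_nhds
    · have h1 : P f = 0 := by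
        refine ext_inner_left ℂ fun k => ?_
        rw [← hPP, inner_zero_right]
        refine tendsto_nhds_unique ?_ (h (P k))
        have : ∀ t, inner ℂ (P k) (Lp.compMeasurePreserving (g t) (hg t) f)
            = inner ℂ (P k) f := by
          intro t
          rw [← hU]
          conv_lhs => rw [← hUP t k]
          exact (U t).inner_map_map _ _
        simp only [this]
        exact tendsto_const_nhds
      simp only [h1, inner_zero_right]
      exact h k
  have hWtop : W = ⊤ := by
    have : CompleteSpace W := hW.completeSpace_coe
    rw [← Submodule.orthogonal_eq_bot_iff, eq_bot_iff, ← hS]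
    exact Submodule.orthogonal_le (Submodule.span_le.2 hSW)
  refine ⟨hg, fun f => ?_⟩
  rw [hPf]
  refine (WeakBilin.tendsto_iff_forall_eval_tendsto _ ?_).2 fun y => ?_
  · intro a b hab
    exact (separatingDual_iff_injective.1 inferInstance) hab
  · obtain ⟨k, rfl⟩ := (InnerProductSpace.toDual ℂ (Lp ℂ 2 μ)).surjective y
    have hf : f ∈ W := hWtop ▸ Submodule.mem_top
    exact hf k

end WeakConvergence

/-! ### Oscillatory integrals whose phase has an absolutely continuous law. -/

section RiemannLebesgue

variable {Ω : Type*} [MeasurableSpace Ω] {μ : Measure Ω}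

lemma tendsto_integral_exp_of_absolutelyContinuous (ν : Measure ℝ) [IsFiniteMeasure ν]
    (hν : ν ≪ volume) :
    Tendsto (fun t : ℝ => ∫ u, Complex.exp (2 * Real.pi * Complex.I * (t * u)) ∂ν) atTop (𝓝 0) := by
  -- The integral is the Fourier transform of the density of `ν`, evaluated at `-t` because of the
  -- sign convention.
  have h := (Real.tendsto_integral_exp_smul_cocompact
    (fun u => (((ν.rnDeriv volume u).toReal : ℝ) : ℂ))).comp
    (tendsto_neg_atTop_atBot.mono_right (atBot_le_cocompact : atBot ≤ cocompact ℝ))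
  refine h.congr fun t => ?_
  have := integral_rnDeriv_smul (μ := ν) (ν := volume) hν
    (f := fun u => Complex.exp (2 * Real.pi * Complex.I * (t * u)))
  rw [← this]
  refine integral_congr_ae (Eventually.of_forall fun u => ?_)
  simp only [Circle.smul_def, Real.fourierChar_apply, smul_eq_mul, Complex.real_smul]
  rw [mul_comm]
  congr 2
  push_cast
  ring

/-- The weight is absorbed into the measure: `h μ` is finite, and its image under `Φ` is still
absolutely continuous. -/
lemma tendsto_integral_exp_mul_ofReal_of_nonneg [SigmaFinite μ] {Φ : Ω → ℝ} (hΦ : AEMeasurable Φ μ)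
    (hac : μ.map Φ ≪ volume) {h : Ω → ℝ} (hh : Integrable h μ) (h0 : 0 ≤ h) :
    Tendsto (fun t : ℝ => ∫ ω, Complex.exp (2 * Real.pi * Complex.I * (t * Φ ω)) * h ω ∂μ)
      atTop (𝓝 0) := by
  set ρ : Measure Ω := μ.withDensity fun ω => ENNReal.ofReal (h ω) with hρ
  have : IsFiniteMeasure ρ := isFiniteMeasure_withDensity_ofReal hh.2
  have hρμ : ρ ≪ μ := withDensity_absolutelyContinuous _ _
  have hΦρ : AEMeasurable Φ ρ := hΦ.mono_ac hρμ
  have hac' : ρ.map Φ ≪ volume := by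
    refine Measure.AbsolutelyContinuous.mk fun s hs h0 => ?_
    rw [Measure.map_apply_of_aemeasurable hΦρ hs]
    apply hρμ
    rw [← Measure.map_apply_of_aemeasurable hΦ hs]
    exact hac h0
  have key := tendsto_integral_exp_of_absolutelyContinuous (ρ.map Φ) hac'
  refine key.congr fun t => ?_
  rw [integral_map hΦρ (Continuous.aestronglyMeasurable (by fun_prop)), hρ,
    integral_withDensity_eq_integral_toReal_smul₀ hh.1.aemeasurable.ennreal_ofReal
      (Eventually.of_forall fun _ => ENNReal.ofReal_lt_top)]
  refine integral_congr_ae (Eventually.of_forall fun ω => ?_)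
  simp only [ENNReal.toReal_ofReal (h0 ω), Complex.real_smul]
  rw [mul_comm]

/-- Riemann-Lebesgue lemma for the oscillating factor `exp (2πi t Φ)`, when the law of `Φ` is
absolutely continuous. -/
lemma tendsto_integral_exp_mul_of_map_absolutelyContinuous [SigmaFinite μ] {Φ : Ω → ℝ}
    (hΦ : AEMeasurable Φ μ) (hac : μ.map Φ ≪ volume) {h : Ω → ℂ} (hh : Integrable h μ) :
    Tendsto (fun t : ℝ => ∫ ω, Complex.exp (2 * Real.pi * Complex.I * (t * Φ ω)) * h ω ∂μ)
      atTop (𝓝 0) := by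
  have hpart : ∀ r : Ω → ℝ, Integrable r μ →
      Integrable (fun ω => max (r ω) 0) μ ∧ Integrable (fun ω => max (-r ω) 0) μ := fun r hr =>
    ⟨hr.pos_part, hr.neg_part⟩
  have hint : ∀ (t : ℝ) (r : Ω → ℝ), Integrable r μ →
      Integrable (fun ω => Complex.exp (2 * Real.pi * Complex.I * (t * Φ ω)) * r ω) μ := by
    intro t r hr
    refine hr.ofReal.bdd_mul (c := 1) ?_ (Eventually.of_forall fun ω => ?_)
    · exact (AEMeasurable.cexp (by fun_prop)).aestronglyMeasurable
    · rw [Complex.norm_exp]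
      simp
  have hreal : ∀ r : Ω → ℝ, Integrable r μ →
      Tendsto (fun t : ℝ => ∫ ω, Complex.exp (2 * Real.pi * Complex.I * (t * Φ ω)) * r ω ∂μ)
        atTop (𝓝 0) := by
    intro r hr
    obtain ⟨h1, h2⟩ := hpart r hr
    have := (tendsto_integral_exp_mul_ofReal_of_nonneg hΦ hac h1 fun _ => le_max_right _ _).sub
      (tendsto_integral_exp_mul_ofReal_of_nonneg hΦ hac h2 fun _ => le_max_right _ _)
    rw [sub_zero] at this
    refine this.congr fun t => ?_
    rw [← integral_sub (hint t _ h1) (hint t _ h2)]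
    refine integral_congr_ae (Eventually.of_forall fun ω => ?_)
    simp only
    rw [← mul_sub, ← Complex.ofReal_sub, max_zero_sub_max_neg_zero_eq_self]
  have := (hreal _ hh.re).add ((hreal _ hh.im).mul_const Complex.I)
  rw [zero_mul, add_zero] at this
  refine this.congr fun t => ?_
  rw [← integral_mul_const, ← integral_add (hint t _ hh.re) ((hint t _ hh.im).mul_const _)]
  refine integral_congr_ae (Eventually.of_forall fun ω => ?_)
  simp only [RCLike.re_eq_complex_re, RCLike.im_eq_complex_im]
  conv_rhs => rw [← Complex.re_add_im (h ω)]
  ring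

end RiemannLebesgue

/-! ### Uniqueness of fibrewise Fourier coefficients. -/

section Totality

variable {Ω : Type*} [m0 : MeasurableSpace Ω] {μ : Measure Ω}

/-- The sets on which an integrable function has zero integral form a Dynkin system. -/
lemma setIntegral_eq_zero_of_generateFrom {f : Ω → ℂ} (hf : Integrable f μ)
    {X : Type*} [mX : MeasurableSpace X] {p : Ω → X} (hp : Measurable p) {C : Set (Set X)}
    (hC : mX = MeasurableSpace.generateFrom C) (hpi : IsPiSystem C)
    (hfC : ∀ s ∈ C, ∫ ω in p ⁻¹' s, f ω ∂μ = 0) (huniv : ∫ ω, f ω ∂μ = 0)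
    {s : Set X} (hs : MeasurableSet s) : ∫ ω in p ⁻¹' s, f ω ∂μ = 0 := by
  induction s, hs using MeasurableSpace.induction_on_inter hC hpi with
  | empty => simp
  | basic t ht => exact hfC t ht
  | compl t htm ih =>
    rw [preimage_compl, setIntegral_compl (hp htm) hf, ih, huniv, sub_zero]
  | iUnion F hd hF ih =>
    rw [preimage_iUnion, integral_iUnion (fun i => hp (hF i)) (fun i j hij => (hd hij).preimage p)
      hf.integrableOn]
    simp [ih]

/-- Integration against `f` is a functional on `C(𝕋^d)` bounded by the L¹ norm of `f`; it kills the
characters, whose span is dense. -/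
lemma integral_continuous_comp_mul_eq_zero {d : ℕ} {f : Ω → ℂ} (hf : Integrable f μ)
    {y : Ω → UnitAddTorus (Fin d)} (hy : Measurable y)
    (h : ∀ ξ : Fin d → ℤ, ∫ ω, UnitAddTorus.mFourier ξ (y ω) * f ω ∂μ = 0)
    (c : C(UnitAddTorus (Fin d), ℂ)) : ∫ ω, c (y ω) * f ω ∂μ = 0 := by
  have hint : ∀ c : C(UnitAddTorus (Fin d), ℂ), Integrable (fun ω => c (y ω) * f ω) μ := fun c =>
    hf.bdd_mul (c := ‖c‖) ((c.continuous.measurable.comp hy).aestronglyMeasurable)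
      (Eventually.of_forall fun ω => c.norm_coe_le_norm _)
  let L : C(UnitAddTorus (Fin d), ℂ) →L[ℂ] ℂ := LinearMap.mkContinuous
    { toFun := fun c => ∫ ω, c (y ω) * f ω ∂μ
      map_add' := fun a b => by
        rw [← integral_add (hint a) (hint b)]
        simp [add_mul]
      map_smul' := fun a b => by
        rw [RingHom.id_apply, smul_eq_mul, ← integral_const_mul]
        simp [mul_assoc] } (∫ ω, ‖f ω‖ ∂μ) fun c => by
      refine (norm_integral_le_integral_norm _).trans ?_
      rw [mul_comm, ← integral_const_mul]
      refine integral_mono (hint c).norm (hf.norm.const_mul _) fun ω => ?_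
      simp only [norm_mul]
      gcongr
      exact c.norm_coe_le_norm _
  have hL : L = 0 := by
    refine ContinuousLinearMap.ext_on (s := range UnitAddTorus.mFourier) ?_ ?_
    · rw [Submodule.dense_iff_topologicalClosure_eq_top]
      exact UnitAddTorus.span_mFourier_closure_eq_top
    · rintro _ ⟨ξ, rfl⟩
      exact h ξ
  exact congrArg (fun l => l c) hL

/-- Indicators of closed sets are bounded pointwise limits of continuous functions, and closed sets
are a π-system generating the Borel sets. -/
lemma setIntegral_preimage_torus_eq_zero {d : ℕ} {f : Ω → ℂ} (hf : Integrable f μ)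
    {y : Ω → UnitAddTorus (Fin d)} (hy : Measurable y)
    (h : ∀ ξ : Fin d → ℤ, ∫ ω, UnitAddTorus.mFourier ξ (y ω) * f ω ∂μ = 0)
    {s : Set (UnitAddTorus (Fin d))} (hs : MeasurableSet s) : ∫ ω in y ⁻¹' s, f ω ∂μ = 0 := by
  have hc := integral_continuous_comp_mul_eq_zero hf hy h
  refine setIntegral_eq_zero_of_generateFrom hf hy
    (BorelSpace.measurable_eq.trans borel_eq_generateFrom_isClosed) isPiSystem_isClosed ?_
    (by simpa using hc 1) hs
  intro F (hF : IsClosed F)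
  let a : ℕ → C(UnitAddTorus (Fin d), ℂ) := fun n =>
    ⟨fun x => ((hF.apprSeq n x : ℝ) : ℂ), by fun_prop⟩
  have hlim : Tendsto (fun n => ∫ ω, a n (y ω) * f ω ∂μ) atTop
      (𝓝 (∫ ω, (y ⁻¹' F).indicator f ω ∂μ)) := by
    refine tendsto_integral_of_dominated_convergence (fun ω => ‖f ω‖) ?_ hf.norm ?_ ?_
    · exact fun n => (((a n).continuous.measurable.comp hy).aestronglyMeasurable).mul hf.1
    · refine fun n => Eventually.of_forall fun ω => ?_
      rw [norm_mul]
      refine mul_le_of_le_one_left (norm_nonneg _) ?_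
      have : hF.apprSeq n (y ω) ≤ 1 := HasOuterApproxClosed.apprSeq_apply_le_one hF n _
      simpa [a] using this
    · refine Eventually.of_forall fun ω => ?_
      have h1 := tendsto_pi_nhds.1 (HasOuterApproxClosed.tendsto_apprSeq hF) (y ω)
      have h2 : Tendsto (fun n => a n (y ω)) atTop
          (𝓝 (((F.indicator (fun _ => (1 : NNReal)) (y ω) : NNReal) : ℝ) : ℂ)) :=
        (Complex.continuous_ofReal.tendsto _).comp ((NNReal.continuous_coe.tendsto _).comp h1)
      have h3 := h2.mul_const (f ω)
      convert h3 using 2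
      by_cases hω : y ω ∈ F <;> simp [hω]
  rw [← integral_indicator (hy hF.measurableSet)]
  exact tendsto_nhds_unique hlim (by simp [hc])

/-- A function whose partial Fourier coefficients over all sets of a fibred space vanish is zero. -/
lemma ae_eq_zero_of_forall_integral_mFourier_eq_zero {d : ℕ} {M : Type*} [MeasurableSpace M]
    {f : Ω → ℂ} (hf : Integrable f μ) {x : Ω → M} (hx : Measurable x)
    {y : Ω → UnitAddTorus (Fin d)} (hy : Measurable y)
    (hxy : ∀ s : Set Ω, MeasurableSet s → ∃ s' : Set (M × UnitAddTorus (Fin d)),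
      MeasurableSet s' ∧ s =ᵐ[μ] (fun ω => (x ω, y ω)) ⁻¹' s')
    (h : ∀ (A : Set M) (_ : MeasurableSet A) (ξ : Fin d → ℤ),
      ∫ ω in x ⁻¹' A, UnitAddTorus.mFourier ξ (y ω) * f ω ∂μ = 0) :
    f =ᵐ[μ] 0 := by
  have hrect : ∀ (A : Set M) (_ : MeasurableSet A) (C : Set (UnitAddTorus (Fin d))),
      MeasurableSet C → ∫ ω in (fun ω => (x ω, y ω)) ⁻¹' (A ×ˢ C), f ω ∂μ = 0 := by
    intro A hA C hC
    have := setIntegral_preimage_torus_eq_zero (μ := μ.restrict (x ⁻¹' A)) hf.restrict hy (h A hA) hC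
    rw [Measure.restrict_restrict (hy hC)] at this
    rwa [mk_preimage_prod, inter_comm]
  refine hf.ae_eq_zero_of_forall_setIntegral_eq_zero fun s hs _ => ?_
  obtain ⟨s', hs', hss'⟩ := hxy s hs
  rw [setIntegral_congr_set hss']
  refine setIntegral_eq_zero_of_generateFrom hf (hx.prodMk hy) generateFrom_prod.symm isPiSystem_prod
    ?_ ?_ hs'
  · rintro _ ⟨A, hA, C, hC, rfl⟩
    exact hrect A hA C hC
  · simpa using hrect univ .univ univ .univ

end Totality

/-! ### Null sets under differentiable maps and submersions. -/

section Null

variable {E F : Type*} [NormedAddCommGroup E] [NormedSpace ℝ E] [FiniteDimensional ℝ E]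
  [MeasurableSpace E] [BorelSpace E] [NormedAddCommGroup F] [NormedSpace ℝ F]
  [FiniteDimensional ℝ F] [MeasurableSpace F] [BorelSpace F]

/-- Differentiable maps between spaces of the same dimension map null sets to null sets. -/
lemma addHaar_image_eq_zero_of_differentiableOn_of_finrank_eq (μ : Measure E) [μ.IsAddHaarMeasure]
    (ν : Measure F) [ν.IsAddHaarMeasure] (hEF : Module.finrank ℝ F = Module.finrank ℝ E)
    {f : E → F} {s : Set E} (hf : DifferentiableOn ℝ f s) (hs : μ s = 0) : ν (f '' s) = 0 := by
  -- Precomposing with a linear isomorphism reduces to self-maps of `F`; it respects null sets by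
  -- uniqueness of Haar measure up to scaling.
  let e : F ≃L[ℝ] E := ContinuousLinearEquiv.ofFinrankEq hEF
  have h1 : ν (e ⁻¹' s) = 0 := by
    have : (ν.map e).IsAddHaarMeasure := e.isAddHaarMeasure_map ν
    have h2 : ν.map e ≪ μ := Measure.absolutelyContinuous_isAddHaarMeasure _ _
    have h3 := h2 hs
    rwa [show (e : F → E) = e.toHomeomorph.toMeasurableEquiv from rfl,
      MeasurableEquiv.map_apply] at h3
  have h4 : f '' s = (f ∘ e) '' (e ⁻¹' s) := by
    rw [image_comp, image_preimage_eq _ e.surjective]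
  rw [h4]
  refine addHaar_image_eq_zero_of_differentiableOn_of_addHaar_eq_zero ν ?_ h1
  exact hf.comp e.differentiable.differentiableOn (mapsTo_preimage _ _)

/-- The preimage of a null set by a `C^1` function is null, outside the critical points. -/
lemma addHaar_preimage_eq_zero_of_fderiv_ne_zero (μ : Measure E) [μ.IsAddHaarMeasure]
    {h : E → ℝ} {O : Set E} (hO : IsOpen O) (hh : ContDiffOn ℝ 1 h O) {N : Set ℝ}
    (hN : volume N = 0) : μ {u | u ∈ O ∧ h u ∈ N ∧ fderiv ℝ h u ≠ 0} = 0 := by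
  refine measure_null_of_locally_null _ fun u₀ ⟨hu₀, _, hne⟩ => ?_
  set L := fderiv ℝ h u₀ with hL
  obtain ⟨w, hw⟩ : ∃ w, L w = 1 := by
    obtain ⟨w, hw⟩ : ∃ w, L w ≠ 0 := by
      by_contra! H
      exact hne (ContinuousLinearMap.ext H)
    exact ⟨(L w)⁻¹ • w, by simp [hw]⟩
  have hLsurj : Function.Surjective L := fun a => ⟨a • w, by simp [hw]⟩
  have hLN : μ (L ⁻¹' N) = 0 := by
    -- The total factor in front of Lebesgue measure may be infinite when `L` has a kernel, which is
    -- harmless as `N` is null.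
    obtain ⟨c, _, _, hc⟩ := LinearMap.exists_map_addHaar_eq_smul_addHaar' (L : E →ₗ[ℝ] ℝ) μ volume
      hLsurj
    refine measure_mono_null (preimage_mono (subset_toMeasurable volume N)) ?_
    have h1 := Measure.map_apply (μ := μ) L.continuous.measurable (measurableSet_toMeasurable volume N)
    rw [← h1]
    change (Measure.map (L : E →ₗ[ℝ] ℝ) μ) _ = 0
    rw [hc]
    simp [hN]
  -- `G` straightens `h` near `u₀`: `L ∘ G = h` and the derivative of `G` at `u₀` is the identity.
  -- The set is thus locally the image of part of `L ⁻¹' N` under the inverse of `G`.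
  let G : E → E := fun u => u + (h u - L u) • w
  have hLG : ∀ u, L (G u) = h u := fun u => by simp [G, hw]
  have hhu : ContDiffAt ℝ 1 h u₀ := hh.contDiffAt (hO.mem_nhds hu₀)
  have hG : ContDiffAt ℝ 1 G u₀ :=
    contDiffAt_id.add ((hhu.sub L.contDiff.contDiffAt).smul contDiffAt_const)
  have hG' : HasFDerivAt G ((ContinuousLinearEquiv.refl ℝ E : E ≃L[ℝ] E) : E →L[ℝ] E) u₀ := by
    have h1 : HasFDerivAt h L u₀ := (hhu.differentiableAt one_ne_zero).hasFDerivAt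
    have h2 := (hasFDerivAt_id u₀).add ((h1.sub L.hasFDerivAt).smul_const w)
    exact h2.congr_fderiv (by ext x; simp)
  let e := hG.toOpenPartialHomeomorph G hG' one_ne_zero
  have he : ∀ u, e u = G u := fun u => rfl
  have hinv : ContDiffAt ℝ 1 e.symm (G u₀) := hG.to_localInverse hG' one_ne_zero
  obtain ⟨V, hV, hVd⟩ : ∃ V ∈ 𝓝 (G u₀), DifferentiableOn ℝ e.symm V := by
    obtain ⟨V, hV, hVd⟩ := hinv.contDiffOn le_rfl (by simp)
    exact ⟨V, hV, hVd.differentiableOn one_ne_zero⟩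
  have hsrc : e.source ∩ G ⁻¹' V ∈ 𝓝 u₀ :=
    inter_mem (e.open_source.mem_nhds (hG.mem_toOpenPartialHomeomorph_source hG' one_ne_zero))
      (hG.continuousAt hV)
  refine ⟨_, inter_mem_nhdsWithin _ hsrc, ?_⟩
  refine measure_mono_null ?_ (addHaar_image_eq_zero_of_differentiableOn_of_addHaar_eq_zero μ
    (hVd.mono (inter_subset_left (t := L ⁻¹' N))) (measure_mono_null inter_subset_right hLN))
  rintro u ⟨⟨_, huN, _⟩, hus, huV⟩
  refine ⟨G u, ⟨huV, ?_⟩, ?_⟩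
  · rw [mem_preimage, hLG]
    exact huN
  · rw [← he, e.left_inv hus]

end Null

/-! ### Null sets of the base and of the total space. -/

lemma continuous_torusMk {d : ℕ} : Continuous (torusMk (d := d)) :=
  continuous_pi fun i => (AddCircle.continuous_mk' 1).comp (continuous_apply i)

lemma surjective_torusMk {d : ℕ} : Function.Surjective (torusMk (d := d)) := fun y => by
  choose z hz using fun i => QuotientAddGroup.mk_surjective (y i)
  exact ⟨z, funext hz⟩

namespace AffineTorusBundle

variable {n d : ℕ} {M Ω : Type*}
  [TopologicalSpace M] [ChartedSpace (EuclideanSpace ℝ (Fin n)) M]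
  [TopologicalSpace Ω] [ChartedSpace (EuclideanSpace ℝ (Fin (n + d))) Ω]

/-- The preimage by the projection of a Lebesgue-null set is Lebesgue-null. -/
lemma lebesgueNull_preimage_proj [IsManifold (𝓡 n) 1 M] [IsManifold (𝓡 (n + d)) 1 Ω]
    (B : AffineTorusBundle n d M Ω) {ψ : Bundle.Trivialization (UnitAddTorus (Fin d)) B.proj}
    (hψ : ψ ∈ B.charts) {χ : OpenPartialHomeomorph M (EuclideanSpace ℝ (Fin n))}
    (hχ : χ ∈ atlas (EuclideanSpace ℝ (Fin n)) M) {S : Set M} (hS : S ⊆ χ.source ∩ ψ.baseSet)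
    (h0 : volume (χ '' S) = 0) : LebesgueNull (k := n + d) (B.proj ⁻¹' S) := by
  intro φ hφ
  -- Lifting the fibre to `ℝ^d` gives a `C^1` map between spaces of dimension `n + d`, under which
  -- the null strip `χ(S) × ℝ^d` covers the preimage of `S`.
  let Θ : EuclideanSpace ℝ (Fin n) × (Fin d → ℝ) → Ω := fun q =>
    ψ.toOpenPartialHomeomorph.symm (χ.symm q.1, torusMk q.2)
  let D : Set (EuclideanSpace ℝ (Fin n) × (Fin d → ℝ)) := (χ '' S) ×ˢ univ ∩ Θ ⁻¹' φ.source
  have hD : ((volume : Measure (EuclideanSpace ℝ (Fin n))).prod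
      (volume : Measure (Fin d → ℝ))) D = 0 := by
    refine measure_mono_null inter_subset_left ?_
    rw [Measure.prod_prod, h0, zero_mul]
  have hF : DifferentiableOn ℝ (φ ∘ Θ) D := by
    rintro ⟨u, z⟩ ⟨⟨⟨x, hx, rfl⟩, -⟩, hφx⟩
    have hxS := hS hx
    have hu : χ x ∈ χ.target := χ.map_source hxS.1
    have hux : χ.symm (χ x) = x := χ.left_inv hxS.1
    have h1 : ContMDiffAt 𝓘(ℝ, EuclideanSpace ℝ (Fin n) × (Fin d → ℝ))
        ((𝓡 n).prod 𝓘(ℝ, Fin d → ℝ)) 1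
        (fun q : EuclideanSpace ℝ (Fin n) × (Fin d → ℝ) => (χ.symm q.1, q.2)) (χ x, z) := by
      refine ContMDiffAt.prodMk ?_ contDiff_snd.contMDiff.contMDiffAt
      exact ContMDiffAt.comp (χ x, z) (contMDiffAt_symm_of_mem_maximalAtlas
        (IsManifold.subset_maximalAtlas hχ) hu) contDiff_fst.contMDiff.contMDiffAt
    have h2 : ContMDiffAt ((𝓡 n).prod 𝓘(ℝ, Fin d → ℝ)) (𝓡 (n + d)) 1
        (fun p : M × (Fin d → ℝ) => ψ.toOpenPartialHomeomorph.symm (p.1, torusMk p.2))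
        (χ.symm (χ x), z) := by
      refine (B.chart_symm_C1 ψ hψ).contMDiffAt ?_
      refine (ψ.open_baseSet.prod isOpen_univ).mem_nhds ⟨?_, trivial⟩
      rw [hux]
      exact hxS.2
    have h3 : ContMDiffAt (𝓡 (n + d)) (𝓡 (n + d)) 1 φ (Θ (χ x, z)) :=
      contMDiffAt_of_mem_maximalAtlas (IsManifold.subset_maximalAtlas hφ) hφx
    have h4 := h3.comp (χ x, z) (ContMDiffAt.comp
      (f := fun q : EuclideanSpace ℝ (Fin n) × (Fin d → ℝ) => (χ.symm q.1, q.2)) (χ x, z) h2 h1)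
    exact (h4.contDiffAt.differentiableAt one_ne_zero).differentiableWithinAt
  have key := addHaar_image_eq_zero_of_differentiableOn_of_finrank_eq _
    (volume : Measure (EuclideanSpace ℝ (Fin (n + d)))) (by simp) hF hD
  refine measure_mono_null ?_ key
  rintro _ ⟨ω, ⟨hωS, hωφ⟩, rfl⟩
  have hω : ω ∈ ψ.source := ψ.mem_source.2 (hS hωS).2
  obtain ⟨z, hz⟩ := surjective_torusMk (ψ ω).2
  have hΘ : Θ (χ (B.proj ω), z) = ω := by
    simp only [Θ]
    rw [χ.left_inv (hS hωS).1, hz, ← ψ.coe_fst hω]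
    exact ψ.toOpenPartialHomeomorph.left_inv hω
  refine ⟨(χ (B.proj ω), z), ⟨⟨⟨_, hωS, rfl⟩, trivial⟩, ?_⟩, ?_⟩
  · rw [mem_preimage, hΘ]
    exact hωφ
  · rw [Function.comp_apply, hΘ]

/-- In each of countably many charts of `M`, the points with value in `N` are either critical, hence
in the null critical set, or regular, where `addHaar_preimage_eq_zero_of_fderiv_ne_zero` applies. -/
lemma measure_preimage_proj_eq_zero_of_velocity [SecondCountableTopology M]
    [IsManifold (𝓡 n) 1 M] [IsManifold (𝓡 (n + d)) 1 Ω] [MeasurableSpace M] [BorelSpace M]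
    [MeasurableSpace Ω] [BorelSpace Ω] (B : AffineTorusBundle n d M Ω) {g : Flow ℝ Ω}
    {μ : Measure Ω} (hμ_ac : AbsContLebesgue (k := n + d) μ)
    (hcrit : LebesgueNull (k := n) (B.criticalSet g))
    {ψ : Bundle.Trivialization (UnitAddTorus (Fin d)) B.proj} (hψ : ψ ∈ B.charts)
    {v : M → (Fin d → ℝ)} (hv : B.IsVelocity g ψ v) {ξ : Fin d → ℤ} (hξ : ξ ≠ 0)
    {N : Set ℝ} (hNm : MeasurableSet N) (hN : volume N = 0) :
    μ (B.proj ⁻¹' (ψ.baseSet ∩ (fun x => ∑ i, (ξ i : ℝ) * v x i) ⁻¹' N)) = 0 := by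
  set f : M → ℝ := fun x => ∑ i, (ξ i : ℝ) * v x i with hf
  have hfC : ContMDiffOn (𝓡 n) 𝓘(ℝ, ℝ) 1 f ψ.baseSet := by
    have : ContDiff ℝ 1 (fun w : Fin d → ℝ => ∑ i, (ξ i : ℝ) * w i) := by fun_prop
    exact this.contMDiff.comp_contMDiffOn hv.1
  obtain ⟨T, hTc, hT⟩ := TopologicalSpace.countable_cover_nhds
    (fun x : M => chart_source_mem_nhds (EuclideanSpace ℝ (Fin n)) x)
  have hcov : B.proj ⁻¹' (ψ.baseSet ∩ f ⁻¹' N) = ⋃ x ∈ T, B.proj ⁻¹'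
      ((chartAt (EuclideanSpace ℝ (Fin n)) x).source ∩ (ψ.baseSet ∩ f ⁻¹' N)) := by
    rw [← preimage_iUnion₂, ← iUnion₂_inter, hT, univ_inter]
  rw [hcov, measure_biUnion_null_iff hTc]
  intro x _
  set χ := chartAt (EuclideanSpace ℝ (Fin n)) x with hχ
  have hχa : χ ∈ atlas (EuclideanSpace ℝ (Fin n)) M := chart_mem_atlas _ x
  have hχm : χ ∈ IsManifold.maximalAtlas (𝓡 n) 1 M :=
      IsManifold.chart_mem_maximalAtlas x
  have hSm : MeasurableSet (χ.source ∩ (ψ.baseSet ∩ f ⁻¹' N)) := by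
    refine χ.open_source.measurableSet.inter ?_
    classical
    have := ((hfC.continuousOn.measurable_piecewise (continuousOn_const (c := (0 : ℝ)))
      ψ.open_baseSet.measurableSet) hNm).inter ψ.open_baseSet.measurableSet
    convert this using 1
    ext y
    by_cases hy : y ∈ ψ.baseSet <;> simp [hy]
  refine hμ_ac _ (B.contMDiff_proj.continuous.measurable hSm)
    (B.lebesgueNull_preimage_proj hψ hχa (fun y hy => ⟨hy.1, hy.2.1⟩) ?_)
  let O : Set (EuclideanSpace ℝ (Fin n)) := χ.target ∩ χ.symm ⁻¹' ψ.baseSet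
  have hO : IsOpen O := χ.isOpen_inter_preimage_symm ψ.open_baseSet
  have hfχ : ContDiffOn ℝ 1 (f ∘ χ.symm) O := by
    rw [← contMDiffOn_iff_contDiffOn]
    exact hfC.comp ((contMDiffOn_symm_of_mem_maximalAtlas hχm).mono inter_subset_left)
      fun u hu => hu.2
  refine measure_mono_null ?_ (measure_union_null (hcrit χ hχa)
    (addHaar_preimage_eq_zero_of_fderiv_ne_zero volume hO hfχ hN))
  rintro _ ⟨y, ⟨hyχ, hyU, hyN⟩, rfl⟩
  have hyy : χ.symm (χ y) = y := χ.left_inv hyχ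
  have hyO : χ y ∈ O := ⟨χ.map_source hyχ, by rwa [mem_preimage, hyy]⟩
  by_cases h0 : fderiv ℝ (f ∘ χ.symm) (χ y) = 0
  · left
    refine ⟨y, ⟨⟨ψ, hψ, hyU, v, hv, ξ, hξ, ?_⟩, hyχ⟩, rfl⟩
    have h1 : f =ᶠ[𝓝 y] (f ∘ χ.symm) ∘ χ := by
      filter_upwards [χ.open_source.mem_nhds hyχ] with z hz
      simp [χ.left_inv hz]
    change mfderiv (𝓡 n) 𝓘(ℝ, ℝ) f y = 0
    rw [h1.mfderiv_eq, mfderiv_comp (I' := 𝓡 n) y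
      ((hfχ.contDiffAt (hO.mem_nhds hyO)).differentiableAt one_ne_zero).mdifferentiableAt
      ((contMDiffAt_of_mem_maximalAtlas hχm hyχ).mdifferentiableAt one_ne_zero),
      mfderiv_eq_fderiv, h0]
    exact ContinuousLinearMap.zero_comp _
  · right
    refine ⟨hyO, ?_, h0⟩
    rw [Function.comp_apply, hyy]
    exact hyN

end AffineTorusBundle

/-! ### Fourier monomials in the fibres and their evolution under the flow. -/

lemma mFourier_add_torusMk {d : ℕ} (ξ : Fin d → ℤ) (y : UnitAddTorus (Fin d)) (w : Fin d → ℝ) :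
    UnitAddTorus.mFourier ξ (y + torusMk w) =
      Complex.exp (2 * Real.pi * Complex.I * (∑ i, (ξ i : ℝ) * w i : ℝ)) *
        UnitAddTorus.mFourier ξ y := by
  simp only [UnitAddTorus.mFourier, ContinuousMap.coe_mk, Pi.add_apply, torusMk]
  rw [Complex.ofReal_sum, Finset.mul_sum, Complex.exp_sum, ← Finset.prod_mul_distrib]
  refine Finset.prod_congr rfl fun i _ => ?_
  rw [fourier_apply, zsmul_add, AddCircle.toCircle_add, Circle.coe_mul, ← fourier_apply,
    ← fourier_apply, fourier_coe_apply, mul_comm]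
  congr 2
  push_cast
  ring

namespace AffineTorusBundle

variable {n d : ℕ} {M Ω : Type*}
  [TopologicalSpace M] [ChartedSpace (EuclideanSpace ℝ (Fin n)) M]
  [TopologicalSpace Ω] [ChartedSpace (EuclideanSpace ℝ (Fin (n + d))) Ω]

open Classical in
/-- The torus coordinate of a trivialization, extended by zero. -/
noncomputable def fiberCoord {B : AffineTorusBundle n d M Ω}
    (ψ : Bundle.Trivialization (UnitAddTorus (Fin d)) B.proj) : Ω → UnitAddTorus (Fin d) :=
  ψ.source.piecewise (fun ω => (ψ ω).2) fun _ => 0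

open Classical in
/-- The velocity in a trivialization, extended by zero. -/
noncomputable def velocityExt {B : AffineTorusBundle n d M Ω}
    (ψ : Bundle.Trivialization (UnitAddTorus (Fin d)) B.proj) (v : M → (Fin d → ℝ)) :
    M → (Fin d → ℝ) :=
  ψ.baseSet.piecewise v fun _ => 0

variable {B : AffineTorusBundle n d M Ω} {g : Flow ℝ Ω}
  {ψ : Bundle.Trivialization (UnitAddTorus (Fin d)) B.proj} {v : M → (Fin d → ℝ)}

lemma velocityExt_of_mem {x : M} (hx : x ∈ ψ.baseSet) : velocityExt ψ v x = v x := by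
  classical
  exact piecewise_eq_of_mem _ _ _ hx

lemma trivialization_apply {ω : Ω} (hω : B.proj ω ∈ ψ.baseSet) :
    ψ ω = (B.proj ω, fiberCoord ψ ω) := by
  have h := ψ.mem_source.2 hω
  classical
  have h' : fiberCoord ψ ω = (ψ ω).2 := piecewise_eq_of_mem _ _ _ h
  rw [h', ← ψ.coe_fst h]

lemma symm_proj_fiberCoord {ω : Ω} (hω : B.proj ω ∈ ψ.baseSet) :
    ψ.toOpenPartialHomeomorph.symm (B.proj ω, fiberCoord ψ ω) = ω := by
  rw [← trivialization_apply hω]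
  exact ψ.toOpenPartialHomeomorph.left_inv (ψ.mem_source.2 hω)

lemma IsVelocity.trivialization_flow (hv : B.IsVelocity g ψ v) (t : ℝ) {ω : Ω}
    (hω : B.proj ω ∈ ψ.baseSet) :
    B.proj (g t ω) = B.proj ω ∧
      fiberCoord ψ (g t ω) = fiberCoord ψ ω + torusMk (t • velocityExt ψ v (B.proj ω)) := by
  have h1 := hv.2 t (B.proj ω) hω (fiberCoord ψ ω)
  rw [symm_proj_fiberCoord hω] at h1
  have h2 : (B.proj ω, fiberCoord ψ ω + torusMk (t • v (B.proj ω))) ∈ ψ.target :=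
    ψ.mem_target.2 hω
  have h3 : B.proj (g t ω) = B.proj ω := by
    rw [h1]
    exact ψ.proj_symm_apply h2
  refine ⟨h3, ?_⟩
  have h4 : ψ (g t ω) = (B.proj ω, fiberCoord ψ ω + torusMk (t • v (B.proj ω))) := by
    rw [h1]
    exact ψ.apply_symm_apply h2
  rw [trivialization_apply (h3 ▸ hω)] at h4
  rw [velocityExt_of_mem hω]
  exact (Prod.ext_iff.1 h4).2

lemma CompatibleFlow.proj_flow (hg : B.CompatibleFlow g) (t : ℝ) (ω : Ω) :
    B.proj (g t ω) = B.proj ω := by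
  obtain ⟨ψ, hψ, hω⟩ := B.exists_chart (B.proj ω)
  obtain ⟨v, hv⟩ := hg ψ hψ
  exact (hv.trivialization_flow t hω).1

lemma exists_countable_charts [SecondCountableTopology M] (B : AffineTorusBundle n d M Ω) :
    ∃ T ⊆ B.charts, T.Countable ∧ ⋃ ψ ∈ T, B.proj ⁻¹' ψ.baseSet = univ := by
  choose c hc hcx using B.exists_chart
  obtain ⟨T, hTc, hT⟩ := TopologicalSpace.countable_cover_nhds
    (fun x : M => (c x).open_baseSet.mem_nhds (hcx x))
  refine ⟨c '' T, by rintro _ ⟨x, -, rfl⟩; exact hc x, hTc.image c, ?_⟩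
  rw [biUnion_image, ← preimage_iUnion₂, hT, preimage_univ]

/-- The Fourier monomial of index `ξ` in the fibres over `A`, read in the chart `ψ`. -/
noncomputable def fiberMonomial (ψ : Bundle.Trivialization (UnitAddTorus (Fin d)) B.proj)
    (A : Set M) (ξ : Fin d → ℤ) : Ω → ℂ :=
  (B.proj ⁻¹' A).indicator fun ω => UnitAddTorus.mFourier ξ (fiberCoord ψ ω)

lemma IsVelocity.fiberMonomial_flow (hg : B.CompatibleFlow g) (hv : B.IsVelocity g ψ v)
    {A : Set M} (hA : A ⊆ ψ.baseSet) (ξ : Fin d → ℤ) (t : ℝ) (ω : Ω) :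
    fiberMonomial ψ A ξ (g t ω) = Complex.exp (2 * Real.pi * Complex.I *
      (t * (∑ i, (ξ i : ℝ) * velocityExt ψ v (B.proj ω) i : ℝ))) * fiberMonomial ψ A ξ ω := by
  by_cases hω : B.proj ω ∈ A
  · have h1 : ω ∈ B.proj ⁻¹' A := hω
    have h2 : g t ω ∈ B.proj ⁻¹' A := by rwa [mem_preimage, hg.proj_flow]
    rw [fiberMonomial, indicator_of_mem h1, indicator_of_mem h2,
      (hv.trivialization_flow t (hA hω)).2, mFourier_add_torusMk]
    congr 3
    rw [← Complex.ofReal_mul, Finset.mul_sum]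
    congr 1
    refine Finset.sum_congr rfl fun i _ => ?_
    rw [Pi.smul_apply, smul_eq_mul]
    ring
  · have h1 : ω ∉ B.proj ⁻¹' A := hω
    have h2 : g t ω ∉ B.proj ⁻¹' A := by rwa [mem_preimage, hg.proj_flow]
    rw [fiberMonomial, indicator_of_notMem h1, indicator_of_notMem h2, mul_zero]

lemma measurable_proj [MeasurableSpace M] [BorelSpace M] [MeasurableSpace Ω] [BorelSpace Ω]
    (B : AffineTorusBundle n d M Ω) : Measurable B.proj :=
  B.contMDiff_proj.continuous.measurable

lemma measurable_fiberCoord [MeasurableSpace Ω] [BorelSpace Ω]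
    (ψ : Bundle.Trivialization (UnitAddTorus (Fin d)) B.proj) :
    Measurable (fiberCoord ψ) := by
  classical
  exact ContinuousOn.measurable_piecewise
    (continuous_snd.comp_continuousOn ψ.toOpenPartialHomeomorph.continuousOn)
    continuousOn_const ψ.open_source.measurableSet

lemma IsVelocity.measurable_velocityExt [MeasurableSpace M] [BorelSpace M]
    (hv : B.IsVelocity g ψ v) : Measurable (velocityExt ψ v) := by
  classical
  exact hv.1.continuousOn.measurable_piecewise continuousOn_const ψ.open_baseSet.measurableSet

variable [MeasurableSpace M] [BorelSpace M] [MeasurableSpace Ω] [BorelSpace Ω] {μ : Measure Ω}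

/-- Measurable sets are, over the base of a chart, pulled back from `M × 𝕋^d`. -/
lemma exists_measurableSet_preimage (ψ : Bundle.Trivialization (UnitAddTorus (Fin d)) B.proj)
    {s : Set Ω} (hs : MeasurableSet s) :
    ∃ s' : Set (M × UnitAddTorus (Fin d)), MeasurableSet s' ∧
      ∀ ω, B.proj ω ∈ ψ.baseSet → (ω ∈ s ↔ (B.proj ω, fiberCoord ψ ω) ∈ s') := by
  classical
  have hm : MeasurableSet (ψ.target ∩ ψ.toOpenPartialHomeomorph.symm ⁻¹' s) := by
    have := ψ.toOpenPartialHomeomorph.symm.continuousOn.domRestrict.measurable hs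
    rw [← Subtype.image_preimage_coe]
    exact (ψ.open_target.measurableSet).subtype_image this
  refine ⟨_, hm, fun ω hω => ?_⟩
  have h2 : (B.proj ω, fiberCoord ψ ω) ∈ ψ.target := ψ.mem_target.2 hω
  rw [mem_inter_iff, mem_preimage, symm_proj_fiberCoord hω]
  exact ⟨fun h => ⟨h2, h⟩, And.right⟩

lemma memLp_fiberMonomial [IsFiniteMeasure μ]
    (ψ : Bundle.Trivialization (UnitAddTorus (Fin d)) B.proj) {A : Set M} (hA : MeasurableSet A)
    (ξ : Fin d → ℤ) : MemLp (fiberMonomial ψ A ξ) 2 μ := by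
  refine MemLp.indicator (B.measurable_proj hA) (MemLp.of_bound ?_ 1 (Eventually.of_forall ?_))
  · exact ((UnitAddTorus.mFourier ξ).continuous.measurable.comp
      (measurable_fiberCoord ψ)).aestronglyMeasurable
  · intro ω
    exact ((UnitAddTorus.mFourier ξ).norm_coe_le_norm _).trans_eq UnitAddTorus.mFourier_norm

lemma aestronglyMeasurable_fiberMonomial_zero (hg : B.CompatibleFlow g) {A : Set M}
    (hA : MeasurableSet A) {f : Ω → ℂ} (hf : f =ᵐ[μ] fiberMonomial ψ A 0) :
    AEStronglyMeasurable[invariantSigmaAlgebra g] f μ := by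
  refine ⟨(B.proj ⁻¹' A).indicator fun _ => (1 : ℂ), ?_, ?_⟩
  · refine stronglyMeasurable_const.indicator (measurableSet_invariantSigmaAlgebra.2 fun t =>
      ⟨B.measurable_proj hA, ?_⟩)
    ext ω
    simp [hg.proj_flow t ω]
  · simpa [fiberMonomial, UnitAddTorus.mFourier_zero] using hf

/-- In the chart, the flow is a skew product over the identity whose fibre maps are translations,
which preserve Haar measure. -/
lemma IsVelocity.measurePreserving_restrict [IsFiniteMeasure μ] (hμ : B.CompatibleMeasure μ)
    (hψ : ψ ∈ B.charts) (hv : B.IsVelocity g ψ v) (t : ℝ) (hgt : Measurable (g t)) :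
    MeasurePreserving (g t) (μ.restrict (B.proj ⁻¹' ψ.baseSet))
      (μ.restrict (B.proj ⁻¹' ψ.baseSet)) := by
  set μU := μ.restrict (B.proj ⁻¹' ψ.baseSet) with hμU
  set Ψ : Ω → M × UnitAddTorus (Fin d) := fun ω => (B.proj ω, fiberCoord ψ ω) with hΨ
  have hUm : MeasurableSet (B.proj ⁻¹' ψ.baseSet) :=
    B.measurable_proj ψ.open_baseSet.measurableSet
  have hΨm : Measurable Ψ := B.measurable_proj.prodMk (measurable_fiberCoord ψ)
  set ρ := ((μ.map B.proj).restrict ψ.baseSet).prod (volume : Measure (UnitAddTorus (Fin d)))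
  have hmap : MeasurePreserving Ψ μU ρ := by
    refine ⟨hΨm, ?_⟩
    refine Eq.trans (Measure.map_congr ?_) (hμ ψ hψ)
    filter_upwards [ae_restrict_mem hUm] with ω hω
    exact (trivialization_apply hω).symm
  let R : M × UnitAddTorus (Fin d) → M × UnitAddTorus (Fin d) := fun p =>
    (p.1, p.2 + torusMk (t • velocityExt ψ v p.1))
  have hR : MeasurePreserving R ρ ρ := by
    refine (MeasurePreserving.id _).skew_product
      (g := fun x y => y + torusMk (t • velocityExt ψ v x)) ?_ ?_
    · exact measurable_snd.add (continuous_torusMk.measurable.comp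
        ((hv.measurable_velocityExt.comp measurable_fst).const_smul t))
    · exact Eventually.of_forall fun x => map_add_right_eq_self _ _
  refine ⟨hgt, Measure.ext fun s hs => ?_⟩
  obtain ⟨s', hs', hss'⟩ := exists_measurableSet_preimage ψ hs
  rw [Measure.map_apply hgt hs]
  have h1 : μU s = ρ s' := by
    rw [← hmap.measure_preimage hs'.nullMeasurableSet]
    refine measure_congr ?_
    filter_upwards [ae_restrict_mem hUm] with ω hω
    exact propext (hss' ω hω)
  have h2 : μU (g t ⁻¹' s) = ρ s' := by
    rw [← (hR.comp hmap).measure_preimage hs'.nullMeasurableSet]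
    refine measure_congr ?_
    filter_upwards [ae_restrict_mem hUm] with ω hω
    obtain ⟨h3, h4⟩ := hv.trivialization_flow t hω
    have h5 := hss' (g t ω) (by rw [h3]; exact hω)
    rw [h3, h4] at h5
    exact propext h5
  rw [h1, h2]

variable [SecondCountableTopology M]

lemma CompatibleFlow.measurePreserving [IsFiniteMeasure μ] (hg : B.CompatibleFlow g)
    (hμ : B.CompatibleMeasure μ) (t : ℝ) : MeasurePreserving (g t) μ μ := by
  have hgt : Measurable (g t) := (g.continuous continuous_const continuous_id).measurable
  obtain ⟨T, hTB, hTc, hT⟩ := B.exists_countable_charts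
  refine ⟨hgt, ?_⟩
  suffices h : (μ.map (g t)).restrict (⋃ ψ ∈ T, B.proj ⁻¹' ψ.baseSet) =
      μ.restrict (⋃ ψ ∈ T, B.proj ⁻¹' ψ.baseSet) by
    rwa [hT, Measure.restrict_univ, Measure.restrict_univ] at h
  refine (Measure.restrict_biUnion_congr hTc).2 fun ψ hψ => ?_
  obtain ⟨v, hv⟩ := hg ψ (hTB hψ)
  have h := hv.measurePreserving_restrict hμ (hTB hψ) t hgt
  rw [Measure.restrict_map hgt (B.measurable_proj ψ.open_baseSet.measurableSet)]
  -- The flow keeps each fibre, so it can be restricted to the part over a chart.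
  have h2 : g t ⁻¹' (B.proj ⁻¹' ψ.baseSet) = B.proj ⁻¹' ψ.baseSet := by
    ext ω
    simp [hg.proj_flow t ω]
  rw [h2, h.map_eq]

variable (B μ) in
/-- The elements of `L²` given by Fourier monomials in the fibres, read in the charts. -/
def fiberMonomials : Set (Lp ℂ 2 μ) :=
  {f | ∃ ψ ∈ B.charts, ∃ A ⊆ ψ.baseSet, MeasurableSet A ∧ ∃ ξ, f =ᵐ[μ] fiberMonomial ψ A ξ}

lemma orthogonal_span_fiberMonomials [IsFiniteMeasure μ] :
    (Submodule.span ℂ (B.fiberMonomials μ))ᗮ = ⊥ := by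
  rw [eq_bot_iff]
  intro k hk
  have hk' : ∀ f ∈ B.fiberMonomials μ, inner ℂ f k = 0 := fun f hf =>
    (Submodule.mem_orthogonal _ _).1 hk f (Submodule.subset_span hf)
  obtain ⟨T, hTB, hTc, hT⟩ := B.exists_countable_charts
  suffices h : ∀ ψ ∈ T, k =ᵐ[μ.restrict (B.proj ⁻¹' ψ.baseSet)] 0 by
    rw [Submodule.mem_bot]
    refine Lp.eq_zero_iff_ae_eq_zero.2 ?_
    have h' : k =ᵐ[μ.restrict (⋃ ψ ∈ T, B.proj ⁻¹' ψ.baseSet)] 0 :=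
      (ae_restrict_biUnion_iff _ hTc _).2 h
    rwa [hT, Measure.restrict_univ] at h'
  intro ψ hψ
  have hUm : MeasurableSet (B.proj ⁻¹' ψ.baseSet) :=
    B.measurable_proj ψ.open_baseSet.measurableSet
  have hki : Integrable k μ := (Lp.memLp k).integrable one_le_two
  refine ae_eq_zero_of_forall_integral_mFourier_eq_zero hki.restrict B.measurable_proj
    (measurable_fiberCoord ψ) (fun s hs => ?_) fun A hA ξ => ?_
  · obtain ⟨s', hs', hss'⟩ := exists_measurableSet_preimage ψ hs
    refine ⟨s', hs', ?_⟩
    filter_upwards [ae_restrict_mem hUm] with ω hω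
    exact propext (hss' ω hω)
  · rw [Measure.restrict_restrict (B.measurable_proj hA), ← preimage_inter]
    have hAU := hA.inter ψ.open_baseSet.measurableSet
    -- The inner product conjugates its first argument, so index `-ξ` produces the coefficient with
    -- `mFourier ξ`.
    have hf := memLp_fiberMonomial (μ := μ) ψ hAU (-ξ)
    have h := hk' (hf.toLp _) ⟨ψ, hTB hψ, _, inter_subset_right, hAU, -ξ, hf.coeFn_toLp⟩
    rw [L2.inner_def] at h
    rw [← integral_indicator (B.measurable_proj hAU), ← h]
    refine integral_congr_ae ?_
    filter_upwards [hf.coeFn_toLp] with ω hω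
    rw [hω, fiberMonomial]
    by_cases hωA : ω ∈ B.proj ⁻¹' (A ∩ ψ.baseSet)
    · rw [indicator_of_mem hωA, indicator_of_mem hωA, UnitAddTorus.mFourier_neg,
        RCLike.inner_apply, Complex.conj_conj, mul_comm]
    · rw [indicator_of_notMem hωA, indicator_of_notMem hωA, inner_zero_left]

lemma map_velocity_absolutelyContinuous [IsManifold (𝓡 n) 1 M] [IsManifold (𝓡 (n + d)) 1 Ω]
    (hμ_ac : AbsContLebesgue (k := n + d) μ) (hcrit : LebesgueNull (k := n) (B.criticalSet g))
    (hψ : ψ ∈ B.charts) (hv : B.IsVelocity g ψ v) {ξ : Fin d → ℤ} (hξ : ξ ≠ 0) :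
    (μ.restrict (B.proj ⁻¹' ψ.baseSet)).map
      (fun ω => ∑ i, (ξ i : ℝ) * velocityExt ψ v (B.proj ω) i) ≪ volume := by
  have hm : Measurable fun ω => ∑ i, (ξ i : ℝ) * velocityExt ψ v (B.proj ω) i :=
    Finset.measurable_sum _ fun i _ => ((measurable_pi_apply i).comp
      (hv.measurable_velocityExt.comp B.measurable_proj)).const_mul _
  refine Measure.AbsolutelyContinuous.mk fun N hNm hN => ?_
  rw [Measure.map_apply hm hNm, Measure.restrict_apply (hm hNm)]
  refine measure_mono_null ?_
    (B.measure_preimage_proj_eq_zero_of_velocity hμ_ac hcrit hψ hv hξ hNm hN)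
  rintro ω ⟨hωN, hωU⟩
  refine ⟨hωU, ?_⟩
  rwa [mem_preimage, velocityExt_of_mem hωU] at hωN

/-- Fourier monomials of nonzero index converge weakly to zero along the flow. -/
lemma tendsto_inner_fiberMonomial [IsFiniteMeasure μ] [IsManifold (𝓡 n) 1 M]
    [IsManifold (𝓡 (n + d)) 1 Ω] (hg : B.CompatibleFlow g)
    (hgμ : ∀ t, MeasurePreserving (g t) μ μ)
    (hμ_ac : AbsContLebesgue (k := n + d) μ) (hcrit : LebesgueNull (k := n) (B.criticalSet g))
    (hψ : ψ ∈ B.charts) {A : Set M} (hA : A ⊆ ψ.baseSet) {ξ : Fin d → ℤ} (hξ : ξ ≠ 0)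
    {f : Lp ℂ 2 μ} (hf : f =ᵐ[μ] fiberMonomial ψ A ξ) (k : Lp ℂ 2 μ) :
    Tendsto (fun t => inner ℂ k (Lp.compMeasurePreserving (g t) (hgμ t) f)) atTop (𝓝 0) := by
  obtain ⟨v, hv⟩ := hg ψ hψ
  have hUm : MeasurableSet (B.proj ⁻¹' ψ.baseSet) :=
    B.measurable_proj ψ.open_baseSet.measurableSet
  have hm : Measurable fun ω => ∑ i, (ξ i : ℝ) * velocityExt ψ v (B.proj ω) i :=
    Finset.measurable_sum _ fun i _ => ((measurable_pi_apply i).comp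
      (hv.measurable_velocityExt.comp B.measurable_proj)).const_mul _
  -- The amplitude `⟨k, f⟩` is integrable as a product of two L² functions; as `f` vanishes off the
  -- chart, integrating over the chart loses nothing.
  have key := tendsto_integral_exp_mul_of_map_absolutelyContinuous hm.aemeasurable
    (map_velocity_absolutelyContinuous hμ_ac hcrit hψ hv hξ)
    (L2.integrable_inner (𝕜 := ℂ) k f).restrict
  refine key.congr fun t => ?_
  rw [L2.inner_def, ← integral_indicator hUm]
  refine integral_congr_ae ?_
  filter_upwards [Lp.coeFn_compMeasurePreserving f (hgμ t), hf,
    (hgμ t).quasiMeasurePreserving.ae_eq_comp hf] with ω h1 h2 h3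
  rw [h1, h3, Function.comp_apply, hv.fiberMonomial_flow hg hA ξ t ω, RCLike.inner_apply]
  by_cases hω : ω ∈ B.proj ⁻¹' ψ.baseSet
  · rw [indicator_of_mem hω, h2, RCLike.inner_apply, ← mul_assoc]
  · have h4 : ω ∉ B.proj ⁻¹' A := fun h => hω (hA h)
    rw [indicator_of_notMem hω, fiberMonomial, indicator_of_notMem h4]
    simp

end AffineTorusBundle

theorem mainTheorem1 {n d : ℕ} (hn : 1 ≤ n) (hd : 1 ≤ d) {M Ω : Type*}
    [TopologicalSpace M] [T2Space M] [SecondCountableTopology M]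
    [ChartedSpace (EuclideanSpace ℝ (Fin n)) M] [IsManifold (𝓡 n) 1 M]
    [MeasurableSpace M] [BorelSpace M]
    [TopologicalSpace Ω] [T2Space Ω] [SecondCountableTopology Ω]
    [ChartedSpace (EuclideanSpace ℝ (Fin (n + d))) Ω] [IsManifold (𝓡 (n + d)) 1 Ω]
    [MeasurableSpace Ω] [BorelSpace Ω]
    (B : AffineTorusBundle n d M Ω)
    (g : Flow ℝ Ω) (hg : B.CompatibleFlow g)
    (μ : Measure Ω) [IsProbabilityMeasure μ]
    (hμ : B.CompatibleMeasure μ) (hμ_ac : AbsContLebesgue (k := n + d) μ)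
    (hcrit : LebesgueNull (k := n) (B.criticalSet g)) :
    KeplerianShear μ g := by
  have hgμ := hg.measurePreserving hμ
  refine KeplerianShear.of_dense_span hgμ (B.fiberMonomials μ)
    AffineTorusBundle.orthogonal_span_fiberMonomials ?_
  rintro f ⟨ψ, hψ, A, hA, hAm, ξ, hf⟩
  rcases eq_or_ne ξ 0 with rfl | hξ
  · exact .inl (AffineTorusBundle.aestronglyMeasurable_fiberMonomial_zero hg hAm hf)
  · exact .inr (AffineTorusBundle.tendsto_inner_fiberMonomial hg hgμ hμ_ac hcrit hψ hA hξ hf)
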